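/- Let $N\ge 1$ and let $J:\mathbb{R}^N\to[0,\infty)$ be continuous and radially symmetric, with $\int_{\mathbb{R}^N} J=1$ and $\operatorname{supp}J=\overline{B}_{R_J}(0)$. Let $\Gamma(s)=\operatorname{sign}(s)\,(|s|-1)_+$. For $g\in L^1(\mathbb{R}^N)$, an $L^1$-solution with datum $g$ of $$u_t=J*\Gamma(u)-\Gamma(u),\qquad u(0)=g, \tag{1}$$ is a curve $u\in C([0,\infty);L^1(\mathbb{R}^N))$ with $u(t)=g+\int_0^t\big(J*\Gamma(u)(s)-\Gamma(u)(s)\big)\,ds$ for all $t\ge0$. Let $f\in L^1(\mathbb{R}^N)$ and $f_\pm=\max(\pm f,0)$; let $\mathbb{U}^{\pm}$ be the $L^1$-solutions of (1) with data $f_\pm$ (solutions of the one-phase problem), and let $$S^\pm=\overline{\bigcup_{t\ge0}\operatorname{supp}_{\mathcal D'}\Gamma(\mathbb{U}^{\pm}(t))}$$ be the limits as $t\to\infty$ of their (nondecreasing) distributional temperature supports. Assume that $$\operatorname{dist}(S^+,S^-)\ge R_J$$ (with the distance to the empty set equal to $+\infty$). If $N=1$ or $N=2$, assume moreover that $J$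 is nonincreasing in the radial variable and that $f_+\le g_1$, $f_-\le g_2$ a.e. for some $g_1,g_2\in L^1(\mathbb{R}^N)\cap C_0(\mathbb{R}^N)$ which are radial and strictly decreasing in the radial variable. Then (1) with datum $f$ has a unique $L^1$-solution $u$; the nonlocal biobstacle problem $$\text{(BOP)}\qquad w\in L^1(\mathbb{R}^N),\qquad |f+J*w-w|\le1,\qquad \big(f+J*w-w-\operatorname{sign}(w)\big)\,|w|=0\quad\text{a.e. in }\mathbb{R}^N$$ (that is, $f+J*w-w\in\beta(w)$ a.e., where $\beta(s)=\{\operatorname{sign}s\}$ for $s\ne0$ and $\beta(0)=[-1,1]$) has a unique solution $w_\infty$; and $$u(t)\to \tilde f:=f+J*w_\infty-w_\infty\quad\text{in }L^1(\mathbb{R}^N)\text{ as }t\to\infty .$$ -/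

import Mathlib

open MeasureTheory Set Filter Topology
open scoped ContDiff Convolution

namespace NonlocalStefan

/-- The space `ℝ^N` with its Euclidean norm. -/
abbrev Space (N : ℕ) : Type := EuclideanSpace ℝ (Fin N)

/-- The space `L¹(ℝ^N)` of (classes of) real integrable functions, with the `L¹` norm. -/
abbrev L1 (N : ℕ) : Type := Lp ℝ 1 (volume : Measure (Space N))

/-- Convolution kernels: continuous, nonnegative, radially symmetric functions of integral `1`
whose support is the closed ball of radius `radius` centred at the origin. -/
structure RadialKernel (N : ℕ) where
  /-- the kernel `J` -/
  toFun : Space N → ℝ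
  /-- the radius `R_J` of its support -/
  radius : ℝ
  continuous_toFun : Continuous toFun
  nonneg : ∀ x, 0 ≤ toFun x
  radial : ∀ x y, ‖x‖ = ‖y‖ → toFun x = toFun y
  tsupport_eq : tsupport toFun = Metric.closedBall 0 radius
  integral_eq_one : ∫ x, toFun x = 1

theorem RadialKernel.integrable {N : ℕ} (J : RadialKernel N) : Integrable J.toFun volume := by
  refine J.continuous_toFun.integrable_of_hasCompactSupport ?_
  rw [HasCompactSupport, J.tsupport_eq]
  exact isCompact_closedBall 0 J.radius

/-- The operator `v ↦ J ∗ v` on `L¹(ℝ^N)`, with `(J ∗ v)(x) = ∫ J(y) v(x - y) dy`. -/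
noncomputable def RadialKernel.conv {N : ℕ} (J : RadialKernel N) (v : L1 N) : L1 N :=
  (J.integrable.integrable_convolution (ContinuousLinearMap.lsmul ℝ ℝ)
    (L1.integrable_coeFn v)).toL1 (J.toFun ⋆[ContinuousLinearMap.lsmul ℝ ℝ, volume] ⇑v)

/-- `J` is nonincreasing in the radial variable. -/
def RadialKernel.RadiallyNonincreasing {N : ℕ} (J : RadialKernel N) : Prop :=
  ∀ x y, ‖x‖ ≤ ‖y‖ → J.toFun y ≤ J.toFun x

/-- The temperature graph `Γ(s) = sign(s) (|s| - 1)₊`. -/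
noncomputable def Gam (s : ℝ) : ℝ := Real.sign s * max (|s| - 1) 0

theorem Gam_eq (s : ℝ) : Gam s = max (s - 1) 0 + min (s + 1) 0 := by
  unfold Gam
  rcases lt_trichotomy s 0 with h | h | h
  · rw [Real.sign_of_neg h, abs_of_neg h, max_eq_right (by linarith : s - 1 ≤ 0)]
    rcases le_total (s + 1) 0 with h1 | h1
    · rw [min_eq_left h1, max_eq_left (by linarith)]; ring
    · rw [min_eq_right h1, max_eq_right (by linarith)]; ring
  · subst h; simp
  · rw [Real.sign_of_pos h, abs_of_pos h, min_eq_right (by linarith : 0 ≤ s + 1)]; ring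

theorem Gam_zero : Gam 0 = 0 := by simp [Gam]

theorem Gam_lipschitz : LipschitzWith 1 Gam := by
  refine LipschitzWith.of_dist_le_mul fun s t => ?_
  rw [Gam_eq, Gam_eq, NNReal.coe_one, one_mul, Real.dist_eq, Real.dist_eq]
  rcases le_total s t with h | h
  · rw [abs_sub_comm s t, abs_of_nonneg (sub_nonneg.2 h)]
    rw [abs_le]
    grind
  · rw [abs_of_nonneg (sub_nonneg.2 h)]
    rw [abs_le]
    grind

/-- The operator `u ↦ Γ(u)` on `L¹(ℝ^N)`. -/
noncomputable def temperature {N : ℕ} (u : L1 N) : L1 N := Gam_lipschitz.compLp Gam_zero u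

/-- `u` is an `L¹`-solution of `u_t = J ∗ Γ(u) - Γ(u)`, `u(0) = f`: a curve in
`C([0,∞); L¹(ℝ^N))` such that `u(t) = f + ∫₀ᵗ (J ∗ Γ(u)(s) - Γ(u)(s)) ds` for all `t ≥ 0`.
Only the restriction of `u` to `[0,∞)` is relevant. -/
def IsL1Solution {N : ℕ} (J : RadialKernel N) (f : L1 N) (u : ℝ → L1 N) : Prop :=
  ContinuousOn u (Ici 0) ∧
    ∀ t : ℝ, 0 ≤ t →
      u t = f + ∫ s in (0 : ℝ)..t, (J.conv (temperature (u s)) - temperature (u s))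

/-- The distributional support of a function `g`: the complement of the largest open set on
which the distribution `φ ↦ ∫ g φ` vanishes. -/
def distSupport {N : ℕ} (g : Space N → ℝ) : Set (Space N) :=
  (⋃₀ {O : Set (Space N) | IsOpen O ∧
    ∀ φ : Space N → ℝ, ContDiff ℝ ∞ φ → HasCompactSupport φ → tsupport φ ⊆ O →
      ∫ x, g x * φ x = 0})ᶜ

/-- The limit as `t → ∞` of the temperature supports `supp Γ(U(t))`, where `U` is the
`L¹`-solution with initial datum `g`: the closure of the union of these sets over `t ≥ 0`.
For `g ≥ 0` (the one-phase case) the sets `supp Γ(U(t))` are nondecreasing in `t`. -/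
def limitTemperatureSupport {N : ℕ} (J : RadialKernel N) (g : L1 N) : Set (Space N) :=
  closure {x | ∃ U : ℝ → L1 N, IsL1Solution J g U ∧
    ∃ t : ℝ, 0 ≤ t ∧ x ∈ distSupport (⇑(temperature (U t)))}

/-- The temperature supports of the one-phase limits of `f₊` and `f₋` are at distance at
least `R_J` (the distance to the empty set being `+∞`). -/
def TemperaturesSeparated {N : ℕ} (J : RadialKernel N) (f : L1 N) : Prop :=
  ∀ x ∈ limitTemperatureSupport J (Lp.posPart f),
    ∀ y ∈ limitTemperatureSupport J (Lp.negPart f), J.radius ≤ dist x y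

/-- `g ∈ L¹(ℝ^N) ∩ C₀(ℝ^N)`, radial and strictly decreasing in the radial variable. -/
structure IsRadialMajorant {N : ℕ} (g : Space N → ℝ) : Prop where
  integrable : Integrable g volume
  continuous : Continuous g
  tendsto_zero : Tendsto g (cocompact (Space N)) (𝓝 0)
  radial : ∀ x y, ‖x‖ = ‖y‖ → g x = g y
  strictAnti : ∀ x y, ‖x‖ < ‖y‖ → g y < g x

/-- The extra hypotheses in dimensions one and two. -/
def LowDimensionHypotheses {N : ℕ} (J : RadialKernel N) (f : L1 N) : Prop :=
  J.RadiallyNonincreasing ∧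
    ∃ g₁ g₂ : Space N → ℝ, IsRadialMajorant g₁ ∧ IsRadialMajorant g₂ ∧
      (∀ᵐ x, max (f x) 0 ≤ g₁ x) ∧ (∀ᵐ x, max (-f x) 0 ≤ g₂ x)

/-- The maximal monotone graph `β` of the sign function: `β(s) = {sign s}` for `s ≠ 0` and
`β(0) = [-1, 1]`. -/
def signGraph (s : ℝ) : Set ℝ := {r | |r| ≤ 1 ∧ (s ≠ 0 → r = Real.sign s)}

/-- `w ∈ L¹(ℝ^N)` solves the nonlocal biobstacle problem with datum `f`:
`f + J ∗ w - w ∈ β(w)` almost everywhere. -/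
def IsBiobstacleSolution {N : ℕ} (J : RadialKernel N) (f w : L1 N) : Prop :=
  ∀ᵐ x, (f + J.conv w - w : L1 N) x ∈ signGraph (w x)

end NonlocalStefan

/-!
The proof rests on the time integral `w(t) = ∫₀ᵗ Γ(u)`, in terms of which the evolution reads
`u(t) = f + J ∗ w(t) - w(t)`. The equation is an ordinary differential equation in `L¹` with a
Lipschitz right-hand side, so solutions exist globally (`exists_global_solution`). It can be written
`u' = Φ(u) - u`, where `Φ(v) = v - Γ(v) + J ∗ Γ(v)` preserves the order and does not increase the
norm; a closed convex set that is mapped into itself by `Φ` is invariant under the flow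
(`mem_of_isClosed_of_convex_of_mapsTo`). This yields comparison, uniqueness and the bound
`‖u(t)‖ ≤ ‖f‖`.

For a nonnegative datum `g` the solution `U` cannot return below `1` once it has reached that value,
so by Chebyshev's inequality all temperatures vanish off one set of measure at most `‖g‖`. On
functions supported in a set of finite measure, `v ↦ v - J ∗ v` is bounded below in `L¹`
(`RadialKernel.exists_norm_le_mul_norm_sub_conv`): convolution with `J` is compact there, and it
has no nonzero fixed point in `L¹` by the strong maximum principle. Since the time integral `W` of
`Γ(U)` satisfies `W - J ∗ W = g - U`, it stays bounded, that is, `‖Γ(U)‖` is integrable in time.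
By comparison with the one-phase solutions issuing from `f₊` and `f₋`, so is `‖Γ(u)‖` for every
solution `u`. Hence `w(t)` converges to some `w∞` and `u(t)` to `f + J ∗ w∞ - w∞` in `L¹`; the
temperature of the limit is zero, so the limit takes its values in `[-1, 1]`.

The separation of the limit supports is used to identify the limit. At points of the positive
support the kernel does not see the negative temperatures, so a point that has once had positive
temperature never falls below `1` afterwards (`IsL1Solution.ae_one_le_of_one_lt`), and the limit is
`1` wherever `w∞ > 0`; applied to `-u`, the same argument gives `-1` wherever `w∞ < 0`. Thus `w∞`
solves the biobstacle problem. Its uniqueness (`IsBiobstacleSolution.eq`) follows from the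
monotonicity of the sign graph and from the absence of fixed points of the convolution.
-/

namespace NonlocalStefan

/-! ### Ordinary differential equations in Banach spaces -/

section BanachODE

variable {E : Type*} [NormedAddCommGroup E] [NormedSpace ℝ E]

/-- A primitive of a curve that is continuous on `[0, ∞)` has a right derivative at each
`t ≥ 0`. -/
theorem hasDerivWithinAt_integral_Ici [CompleteSpace E] {g : ℝ → E} (hg : ContinuousOn g (Ici 0))
    {t : ℝ} (ht : 0 ≤ t) :
    HasDerivWithinAt (fun t => ∫ s in (0 : ℝ)..t, g s) (g t) (Ici t) t := by
  have hsub : Ici t ⊆ Ici (0 : ℝ) := Ici_subset_Ici.2 ht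
  refine intervalIntegral.integral_hasDerivWithinAt_right (s := Ici t) (t := Ioi t) ?_ ?_ ?_
  · refine ContinuousOn.intervalIntegrable (hg.mono ?_)
    rw [uIcc_of_le ht]
    exact Icc_subset_Ici_self
  · refine ⟨Ioi t, self_mem_nhdsWithin, ?_⟩
    exact (hg.mono (Ioi_subset_Ici_self.trans hsub)).aestronglyMeasurable measurableSet_Ioi
  · exact ((hg t ht).mono hsub).mono Ioi_subset_Ici_self

/-- **Flow invariance of closed convex sets.** If each `H t` is Lipschitz and maps the closed
convex set `K` into itself, then the solutions of `x' = H t x - x` do not leave `K`: an Euler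
step of length `h ≤ 1` is a convex combination of a point of `K` and its image under `H t`, so
that the distance to `K` satisfies a Gronwall inequality. -/
theorem mem_of_isClosed_of_convex_of_mapsTo {K : Set E} (hK : IsClosed K) (hconv : Convex ℝ K)
    {H : ℝ → E → E} {L : NNReal} {x : ℝ → E} {a : ℝ} (hx : ContinuousOn x (Ici a))
    (hx' : ∀ t, a ≤ t → HasDerivWithinAt x (H t (x t) - x t) (Ici t) t)
    (hL : ∀ t, a ≤ t → LipschitzWith L (H t)) (hH : ∀ t, a ≤ t → MapsTo (H t) K K)
    (h0 : x a ∈ K) {b : ℝ} (hb : a ≤ b) : x b ∈ K := by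
  have hne : K.Nonempty := ⟨_, h0⟩
  have key := le_gronwallBound_of_liminf_deriv_right_le (f := fun t => Metric.infDist (x t) K)
    (f' := fun t => L * Metric.infDist (x t) K) (δ := 0) (K := L) (ε := 0) (a := a) (b := b)
    ((Metric.continuous_infDist_pt K).comp_continuousOn (hx.mono Icc_subset_Ici_self)) ?_
    (by simp [Metric.infDist_zero_of_mem h0]) (by simp) b ⟨hb, le_rfl⟩
  · rw [gronwallBound_ε0_δ0] at key
    rw [hK.mem_iff_infDist_zero hne]
    exact le_antisymm key Metric.infDist_nonneg
  · intro t ht r hr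
    refine Eventually.frequently ?_
    set d := Metric.infDist (x t) K with hd
    set ε := (r - L * d) / 2 with hε
    have hεpos : 0 < ε := by simp only [hε]; linarith
    have hd0 : 0 ≤ d := Metric.infDist_nonneg
    have h1 := (hasDerivWithinAt_iff_isLittleO.1 (hx' t ht.1)).def hεpos
    have h1' := h1.filter_mono (nhdsWithin_mono t Ioi_subset_Ici_self)
    have h2 : ∀ᶠ z in 𝓝[>] t, z ∈ Ioo t (t + 1) := Ioo_mem_nhdsGT (by linarith)
    filter_upwards [h1', h2] with z hz1 hz2
    set h := z - t with hh
    have hpos : 0 < h := sub_pos.2 hz2.1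
    have hlt : h < 1 := by have := hz2.2; simp only [hh]; linarith
    set y := x t + h • (H t (x t) - x t) with hy
    have hc : 0 < 1 - h + h * L := by
      have : 0 ≤ h * (L : ℝ) := by positivity
      linarith
    have hyK : Metric.infDist y K ≤ (1 - h + h * L) * d := by
      rw [← div_le_iff₀' hc, hd, Metric.le_infDist hne]
      intro p hp
      rw [div_le_iff₀' hc]
      have hmem : (1 - h) • p + h • H t p ∈ K :=
        hconv hp (hH t ht.1 hp) (by linarith) hpos.le (by ring)
      refine (Metric.infDist_le_dist_of_mem hmem).trans ?_
      have e : y - ((1 - h) • p + h • H t p) = (1 - h) • (x t - p) + h • (H t (x t) - H t p) := by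
        simp only [hy]; module
      rw [dist_eq_norm, e]
      refine (norm_add_le _ _).trans ?_
      rw [norm_smul, norm_smul, Real.norm_of_nonneg hpos.le,
        Real.norm_of_nonneg (by linarith : 0 ≤ 1 - h), dist_eq_norm]
      have := (hL t ht.1).dist_le_mul (x t) p
      rw [dist_eq_norm, dist_eq_norm] at this
      nlinarith
    have hxy : dist (x z) y ≤ ε * h := by
      rw [Real.norm_of_nonneg hpos.le] at hz1
      rwa [dist_eq_norm, hy, ← sub_sub]
    have hz : Metric.infDist (x z) K ≤ Metric.infDist y K + dist (x z) y :=
      Metric.infDist_le_infDist_add_dist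
    change h⁻¹ * (Metric.infDist (x z) K - d) < r
    rw [inv_mul_lt_iff₀ hpos]
    have : r = 2 * ε + L * d := by simp only [hε]; ring
    rw [this]
    nlinarith [mul_nonneg hpos.le hd0, mul_pos hεpos hpos]

/-- Global existence for `x' = F x` with `F` Lipschitz and `F 0 = 0`. The unknown
`y t = exp (-2 C t) x t` is a fixed point of a contraction of the bounded continuous curves. -/
theorem exists_global_solution [CompleteSpace E] {F : E → E} {C : NNReal} (hC : 0 < C)
    (hF : LipschitzWith C F) (hF0 : F 0 = 0) (x₀ : E) :
    ∃ x : ℝ → E, Continuous x ∧ ∀ t, 0 ≤ t → x t = x₀ + ∫ s in (0 : ℝ)..t, F (x s) := by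
  have hFle : ∀ v, ‖F v‖ ≤ C * ‖v‖ := fun v => by
    simpa [hF0] using hF.norm_sub_le v 0
  set c : ℝ := 2 * C with hc
  have hCpos : (0 : ℝ) < C := hC
  have hcpos : 0 < c := by positivity
  let I : (ℝ → E) → ℝ → E := fun y s => F (Real.exp (c * s) • y s)
  have hIc : ∀ y : BoundedContinuousFunction ℝ E, Continuous (I y) := fun y => by
    refine hF.continuous.comp ?_
    exact (by fun_prop : Continuous fun s => Real.exp (c * s)).smul y.continuous
  let P : (ℝ → E) → ℝ → E := fun y t =>
    Real.exp (-(c * max t 0)) • (x₀ + ∫ s in (0 : ℝ)..(max t 0), I y s)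
  have hPc : ∀ y : BoundedContinuousFunction ℝ E, Continuous (P y) := fun y => by
    refine (by fun_prop : Continuous fun t : ℝ => Real.exp (-(c * max t 0))).smul ?_
    refine continuous_const.add ?_
    exact (intervalIntegral.continuous_primitive
      (fun a b => (hIc y).intervalIntegrable a b) 0).comp (continuous_id.max continuous_const)
  -- the weight with exponent `2 C` makes the integral operator contract by the factor `1 / 2`
  have hbound : ∀ (g : ℝ → E) (M t : ℝ), 0 ≤ M →
      (∀ s, ‖g s‖ ≤ C * (Real.exp (c * s) * M)) →
      ‖Real.exp (-(c * max t 0)) • ∫ s in (0 : ℝ)..(max t 0), g s‖ ≤ M / 2 := by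
    intro g M t hM hg
    set τ := max t 0 with hτ
    have hτ0 : 0 ≤ τ := le_max_right _ _
    have h1 : ‖∫ s in (0 : ℝ)..τ, g s‖ ≤ ∫ s in (0 : ℝ)..τ, C * (Real.exp (c * s) * M) :=
      intervalIntegral.norm_integral_le_of_norm_le hτ0 (Eventually.of_forall fun s _ => hg s)
        (Continuous.intervalIntegrable (by fun_prop) _ _)
    have h2 : ∫ s in (0 : ℝ)..τ, C * (Real.exp (c * s) * M) =
        C * ((c⁻¹ * (Real.exp (c * τ) - 1)) * M) := by
      rw [intervalIntegral.integral_const_mul, intervalIntegral.integral_mul_const,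
        intervalIntegral.integral_comp_mul_left (fun s => Real.exp s) hcpos.ne', integral_exp]
      simp
    rw [norm_smul, Real.norm_of_nonneg (Real.exp_pos _).le]
    calc Real.exp (-(c * τ)) * ‖∫ s in (0 : ℝ)..τ, g s‖
        ≤ Real.exp (-(c * τ)) * (C * ((c⁻¹ * (Real.exp (c * τ) - 0)) * M)) := by
          refine mul_le_mul_of_nonneg_left ?_ (Real.exp_pos _).le
          rw [h2] at h1
          refine h1.trans ?_
          gcongr
          norm_num
      _ = M / 2 * (Real.exp (-(c * τ)) * Real.exp (c * τ)) := by
          rw [hc]; field_simp; ring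
      _ = M / 2 := by rw [← Real.exp_add]; simp
  have hPb : ∀ y : BoundedContinuousFunction ℝ E, ∀ t, ‖P y t‖ ≤ ‖x₀‖ + ‖y‖ / 2 := by
    intro y t
    simp only [P, smul_add]
    refine (norm_add_le _ _).trans (add_le_add ?_ ?_)
    · rw [norm_smul, Real.norm_of_nonneg (Real.exp_pos _).le]
      refine mul_le_of_le_one_left (norm_nonneg _) (Real.exp_le_one_iff.2 ?_)
      exact neg_nonpos.2 (mul_nonneg hcpos.le (le_max_right _ _))
    · refine hbound _ _ t (norm_nonneg y) fun s => (hFle _).trans ?_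
      rw [norm_smul, Real.norm_of_nonneg (Real.exp_pos _).le]
      gcongr
      exact y.norm_coe_le_norm s
  let Φ : BoundedContinuousFunction ℝ E → BoundedContinuousFunction ℝ E := fun y =>
    BoundedContinuousFunction.ofNormedAddCommGroup (P y) (hPc y) _ (hPb y)
  have hΦ : ContractingWith (1 / 2) Φ := by
    refine ⟨by rw [← NNReal.coe_lt_coe]; norm_num, LipschitzWith.of_dist_le_mul fun y z => ?_⟩
    have hdist : (0 : ℝ) ≤ ((1 / 2 : NNReal) : ℝ) * dist y z := by positivity
    rw [BoundedContinuousFunction.dist_le hdist]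
    intro t
    have e : P y t - P z t =
        Real.exp (-(c * max t 0)) • ∫ s in (0 : ℝ)..(max t 0), (I y s - I z s) := by
      simp only [P]
      rw [intervalIntegral.integral_sub ((hIc y).intervalIntegrable _ _)
        ((hIc z).intervalIntegrable _ _), ← smul_sub, add_sub_add_left_eq_sub]
    change dist (P y t) (P z t) ≤ _
    rw [dist_eq_norm, e]
    refine (hbound _ (dist y z) t dist_nonneg fun s => ?_).trans (le_of_eq ?_)
    · refine (hF.norm_sub_le _ _).trans ?_
      rw [← smul_sub, norm_smul, Real.norm_of_nonneg (Real.exp_pos _).le, ← dist_eq_norm]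
      gcongr
      exact BoundedContinuousFunction.dist_coe_le_dist s
    · push_cast; ring
  set y := hΦ.fixedPoint with hy
  have hfix : Φ y = y := hΦ.fixedPoint_isFixedPt
  refine ⟨fun t => Real.exp (c * t) • y t,
    (by fun_prop : Continuous fun s => Real.exp (c * s)).smul y.continuous, fun t ht => ?_⟩
  have : y t = P y t := by
    conv_lhs => rw [← hfix]
    rfl
  change Real.exp (c * t) • y t = _
  rw [this]
  simp only [P, max_eq_left ht, smul_smul, ← Real.exp_add, add_neg_cancel, Real.exp_zero, one_smul]
  rfl

/-- The limit at infinity of a function that is integrable on `(0, ∞)` is zero. -/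
theorem eq_zero_of_tendsto_of_integrableOn_Ioi {φ : ℝ → ℝ} {l : ℝ} (hl : Tendsto φ atTop (𝓝 l))
    (hφ : IntegrableOn φ (Ioi 0)) : l = 0 := by
  by_contra hne
  have hpos : 0 < |l| := abs_pos.2 hne
  obtain ⟨T, hT⟩ := eventually_atTop.1 ((hl.abs.eventually (lt_mem_nhds (half_lt_self hpos))))
  have h1 : IntegrableOn (fun _ : ℝ => |l| / 2) (Ioi (max T 0)) := by
    refine Integrable.mono' ((hφ.mono_set (Ioi_subset_Ioi (le_max_right T 0))).norm)
      aestronglyMeasurable_const ?_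
    filter_upwards [ae_restrict_mem measurableSet_Ioi] with s hs
    rw [Real.norm_of_nonneg (by positivity)]
    exact (hT s ((le_max_left T 0).trans (le_of_lt hs))).le
  rw [integrableOn_const_iff] at h1
  simp [hne] at h1

end BanachODE

/-! ### The convolution operator -/

namespace RadialKernel

variable {N : ℕ} (J : RadialKernel N)

theorem hasCompactSupport : HasCompactSupport J.toFun := by
  rw [HasCompactSupport, J.tsupport_eq]
  exact isCompact_closedBall 0 J.radius

theorem exists_bound : ∃ C : ℝ, 0 ≤ C ∧ ∀ x, ‖J.toFun x‖ ≤ C := by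
  obtain ⟨C, hC⟩ := J.continuous_toFun.bounded_above_of_compact_support J.hasCompactSupport
  exact ⟨C, (norm_nonneg _).trans (hC 0), hC⟩

theorem integral_comp_sub_left (x : Space N) : ∫ y, J.toFun (x - y) = 1 := by
  rw [integral_sub_left_eq_self J.toFun volume x, J.integral_eq_one]

theorem nontrivial_space (hN : 1 ≤ N) : Nontrivial (Space N) := by
  have : Nonempty (Fin N) := ⟨⟨0, hN⟩⟩
  infer_instance

/-- In positive dimension the radius of the support is positive, because a single point is a
null set and cannot carry the unit mass of the kernel. -/
theorem radius_pos (hN : 1 ≤ N) : 0 < J.radius := by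
  have := nontrivial_space hN
  by_contra hr
  have hzero : ∀ᵐ x, J.toFun x = 0 := by
    have h0 : ∀ᵐ x : Space N, x ≠ 0 := by simp [ae_iff]
    filter_upwards [h0] with x hx
    by_contra hJ
    have hmem : x ∈ Metric.closedBall (0 : Space N) J.radius :=
      J.tsupport_eq ▸ subset_tsupport J.toFun hJ
    rw [mem_closedBall_zero_iff] at hmem
    exact hx (norm_le_zero_iff.1 (hmem.trans (not_lt.1 hr)))
  have := J.integral_eq_one
  rw [integral_eq_zero_of_ae hzero] at this
  exact zero_ne_one this

/-- The kernel also vanishes on the sphere bounding its support, by continuity. -/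
theorem toFun_eq_zero (hN : 1 ≤ N) {x : Space N} (hx : J.radius ≤ ‖x‖) : J.toFun x = 0 := by
  have hpos : 0 < ‖x‖ := (J.radius_pos hN).trans_le hx
  have hlim : Tendsto (fun c : ℝ => J.toFun (c • x)) (𝓝[>] 1) (𝓝 (J.toFun x)) := by
    have : Continuous fun c : ℝ => J.toFun (c • x) :=
      J.continuous_toFun.comp (continuous_id.smul continuous_const)
    simpa using (this.tendsto 1).mono_left nhdsWithin_le_nhds
  refine tendsto_nhds_unique hlim (tendsto_const_nhds.congr' ?_)
  filter_upwards [self_mem_nhdsWithin] with c hc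
  by_contra hJ
  have hmem : c • x ∈ Metric.closedBall (0 : Space N) J.radius :=
    J.tsupport_eq ▸ subset_tsupport J.toFun (Ne.symm hJ)
  rw [mem_closedBall_zero_iff, norm_smul, Real.norm_of_nonneg (zero_le_one.trans (le_of_lt hc))]
    at hmem
  have : 1 < c := hc
  nlinarith

/-- The continuous representative `x ↦ ∫ J(x - y) v(y) dy` of `J ∗ v`. -/
noncomputable def mollify (v : L1 N) (x : Space N) : ℝ := ∫ y, J.toFun (x - y) * v y

theorem integrable_mul (v : L1 N) (x : Space N) :
    Integrable (fun y => J.toFun (x - y) * v y) := by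
  obtain ⟨C, -, hC⟩ := J.exists_bound
  refine (L1.integrable_coeFn v).bdd_mul (c := C) ?_ (Eventually.of_forall fun y => hC _)
  exact (J.continuous_toFun.comp (continuous_const.sub continuous_id)).aestronglyMeasurable

theorem coeFn_conv (v : L1 N) : J.conv v =ᵐ[volume] J.mollify v := by
  refine (Integrable.coeFn_toL1 _).trans (Eventually.of_forall fun x => ?_)
  exact convolution_lsmul_swap

theorem conv_add (v w : L1 N) : J.conv (v + w) = J.conv v + J.conv w := by
  apply Lp.ext
  filter_upwards [J.coeFn_conv (v + w), J.coeFn_conv v, J.coeFn_conv w,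
    Lp.coeFn_add (J.conv v) (J.conv w)] with x h1 h2 h3 h4
  rw [h1, h4, Pi.add_apply, h2, h3, mollify, mollify, mollify,
    ← integral_add (J.integrable_mul v x) (J.integrable_mul w x)]
  refine integral_congr_ae ?_
  filter_upwards [Lp.coeFn_add v w] with y hy
  rw [hy, Pi.add_apply, mul_add]

theorem conv_smul (c : ℝ) (v : L1 N) : J.conv (c • v) = c • J.conv v := by
  apply Lp.ext
  filter_upwards [J.coeFn_conv (c • v), J.coeFn_conv v,
    Lp.coeFn_smul c (J.conv v)] with x h1 h2 h3
  rw [h1, h3, Pi.smul_apply, h2, mollify, mollify, smul_eq_mul, ← integral_const_mul]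
  refine integral_congr_ae ?_
  filter_upwards [Lp.coeFn_smul c v] with y hy
  rw [hy, Pi.smul_apply, smul_eq_mul]
  ring

theorem norm_conv_le (v : L1 N) : ‖J.conv v‖ ≤ ‖v‖ := by
  have hv := (L1.integrable_coeFn v).norm
  have hint := J.integrable.integrable_convolution (ContinuousLinearMap.lsmul ℝ ℝ) hv
  have h1 := integral_convolution (ContinuousLinearMap.lsmul ℝ ℝ) J.integrable hv
  rw [ContinuousLinearMap.lsmul_apply, J.integral_eq_one, one_smul, ← L1.norm_eq_integral_norm]
    at h1
  rw [L1.norm_eq_integral_norm, ← h1]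
  refine integral_mono_ae (L1.integrable_coeFn _).norm hint ?_
  filter_upwards [J.coeFn_conv v] with x hx
  simp only [hx]
  refine (norm_integral_le_integral_norm _).trans (le_of_eq ?_)
  refine Eq.trans ?_ convolution_lsmul_swap.symm
  refine integral_congr_ae (Eventually.of_forall fun y => ?_)
  simp only [norm_mul, Real.norm_of_nonneg (J.nonneg _), smul_eq_mul]

/-- The convolution operator as a continuous linear map. -/
noncomputable def convL : L1 N →L[ℝ] L1 N :=
  LinearMap.mkContinuous
    { toFun := J.conv, map_add' := J.conv_add, map_smul' := J.conv_smul } 1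
    fun v => by simpa using J.norm_conv_le v

theorem convL_apply (v : L1 N) : J.convL v = J.conv v := rfl

theorem conv_sub (v w : L1 N) : J.conv (v - w) = J.conv v - J.conv w := J.convL.map_sub v w

theorem conv_neg (v : L1 N) : J.conv (-v) = -J.conv v := J.convL.map_neg v

theorem conv_zero : J.conv (0 : L1 N) = 0 := J.convL.map_zero

theorem mollify_nonneg {v : L1 N} {x : Space N} (h : ∀ᵐ y, 0 ≤ J.toFun (x - y) * v y) :
    0 ≤ J.mollify v x :=
  integral_nonneg_of_ae h

theorem conv_nonneg {v : L1 N} (hv : 0 ≤ v) : 0 ≤ J.conv v := by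
  rw [← Lp.coeFn_nonneg] at hv ⊢
  filter_upwards [J.coeFn_conv v] with x hx
  rw [hx]
  refine J.mollify_nonneg ?_
  filter_upwards [hv] with y hy using mul_nonneg (J.nonneg _) hy

theorem conv_mono {v w : L1 N} (h : v ≤ w) : J.conv v ≤ J.conv w := by
  rw [← sub_nonneg, ← J.conv_sub]
  exact J.conv_nonneg (sub_nonneg.2 h)

theorem norm_mollify_le {C : ℝ} (hC : ∀ x, ‖J.toFun x‖ ≤ C) (v : L1 N) (x : Space N) :
    ‖J.mollify v x‖ ≤ C * ‖v‖ := by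
  rw [L1.norm_eq_integral_norm, ← integral_const_mul]
  refine (norm_integral_le_integral_norm _).trans ?_
  refine integral_mono (J.integrable_mul v x).norm ((L1.integrable_coeFn v).norm.const_mul C) ?_
  intro y
  simp only [norm_mul]
  gcongr
  exact hC _

theorem norm_mollify_sub_le {ε δ : ℝ}
    (h : ∀ z z', dist z z' < δ → dist (J.toFun z) (J.toFun z') ≤ ε) (v : L1 N)
    {x x' : Space N} (hx : dist x x' < δ) : ‖J.mollify v x - J.mollify v x'‖ ≤ ε * ‖v‖ := by
  rw [mollify, mollify, ← integral_sub (J.integrable_mul v x) (J.integrable_mul v x'),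
    L1.norm_eq_integral_norm, ← integral_const_mul]
  refine (norm_integral_le_integral_norm _).trans ?_
  refine integral_mono ((J.integrable_mul v x).sub (J.integrable_mul v x')).norm
    ((L1.integrable_coeFn v).norm.const_mul ε) ?_
  intro y
  simp only [← sub_mul, norm_mul]
  gcongr
  rw [← dist_eq_norm]
  exact h _ _ (by rwa [dist_sub_right])

/-- The functions `J ∗ v`, for `v` in the unit ball of `L¹`, are uniformly equicontinuous. -/
theorem exists_modulus {ε : ℝ} (hε : 0 < ε) :
    ∃ δ > 0, ∀ (v : L1 N) {x x' : Space N}, dist x x' < δ →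
      ‖J.mollify v x - J.mollify v x'‖ ≤ ε * ‖v‖ := by
  have huc := J.hasCompactSupport.uniformContinuous_of_continuous J.continuous_toFun
  obtain ⟨δ, hδ, h⟩ := Metric.uniformContinuous_iff.1 huc ε hε
  exact ⟨δ, hδ, fun v x x' hx =>
    J.norm_mollify_sub_le (fun z z' hz => (h hz).le) v hx⟩

theorem continuous_mollify (v : L1 N) : Continuous (J.mollify v) := by
  rw [Metric.continuous_iff]
  intro x ε hε
  have hpos : 0 < ‖v‖ + 1 := by positivity
  obtain ⟨δ, hδ, h⟩ := J.exists_modulus (div_pos hε hpos)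
  refine ⟨δ, hδ, fun y hy => ?_⟩
  rw [dist_eq_norm]
  refine (h v hy).trans_lt ?_
  rw [div_mul_eq_mul_div, div_lt_iff₀ hpos]
  nlinarith

theorem tendsto_mollify_cocompact (v : L1 N) :
    Tendsto (J.mollify v) (cocompact (Space N)) (𝓝 0) := by
  obtain ⟨C, -, hC⟩ := J.exists_bound
  have : (cocompact (Space N)).IsCountablyGenerated := by
    rw [← Metric.cobounded_eq_cocompact, ← comap_norm_atTop]
    infer_instance
  have := tendsto_integral_filter_of_dominated_convergence (l := cocompact (Space N))
    (μ := (volume : Measure (Space N)))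
    (F := fun x y => J.toFun (x - y) * v y) (f := fun _ => 0) (fun y => C * ‖v y‖)
    (Eventually.of_forall fun x => (J.integrable_mul v x).aestronglyMeasurable)
    (Eventually.of_forall fun x => Eventually.of_forall fun y => ?_)
    ((L1.integrable_coeFn v).norm.const_mul C) (Eventually.of_forall fun y => ?_)
  · rwa [integral_zero] at this
  · rw [norm_mul]
    gcongr
    exact hC _
  · have h1 : Tendsto (fun x => x - y) (cocompact (Space N)) (cocompact (Space N)) :=
      (Homeomorph.subRight y).isClosedEmbedding.tendsto_cocompact
    have h2 : Tendsto J.toFun (cocompact (Space N)) (𝓝 0) := J.hasCompactSupport.is_zero_at_infty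
    simpa using (h2.comp h1).mul_const (v y)

/-- **Strong maximum principle.** A continuous function vanishing at infinity that is equal to
its convolution with `J` is nonpositive: the set where it attains a positive maximum would be
open and closed. -/
theorem nonpos_of_conv_eq_self (hN : 1 ≤ N) {v : L1 N} (hv : J.conv v = v) (x₀ : Space N) :
    J.mollify v x₀ ≤ 0 := by
  have := nontrivial_space hN
  by_contra! hpos
  set h := J.mollify v with hh
  have hcont : Continuous h := J.continuous_mollify v
  have hlim : Tendsto h (cocompact (Space N)) (𝓝 0) := J.tendsto_mollify_cocompact v
  have hvh : v =ᵐ[volume] h := by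
    conv_lhs => rw [← hv]
    exact J.coeFn_conv v
  obtain ⟨x₁, hx₁⟩ := hcont.exists_forall_ge' x₀
    ((hlim.eventually (gt_mem_nhds hpos)).mono fun _ hx => le_of_lt hx)
  set m := h x₁ with hm
  have hmpos : 0 < m := hpos.trans_le (hx₁ x₀)
  have hstep : ∀ x, h x = m → ∀ z ∈ Metric.closedBall (0 : Space N) J.radius, h (x - z) = m := by
    intro x hx
    have hJ : Continuous fun y => J.toFun (x - y) :=
      J.continuous_toFun.comp (continuous_const.sub continuous_id)
    have hi1 : Integrable fun y => J.toFun (x - y) * m :=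
      (J.integrable.comp_sub_left x).mul_const m
    have hi2 : Integrable fun y => J.toFun (x - y) * h y := by
      refine (J.integrable_mul v x).congr ?_
      filter_upwards [hvh] with y hy
      rw [hy]
    have e1 : ∫ y, J.toFun (x - y) * h y = m := by
      rw [← hx, hh, mollify]
      refine integral_congr_ae ?_
      filter_upwards [hvh] with y hy
      rw [hy]
    have e2 : ∫ y, J.toFun (x - y) * m = m := by
      rw [integral_mul_const, J.integral_comp_sub_left, one_mul]
    have hzero : ∫ y, (J.toFun (x - y) * m - J.toFun (x - y) * h y) = 0 := by
      rw [integral_sub hi1 hi2, e1, e2, sub_self]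
    have hnn : 0 ≤ fun y => J.toFun (x - y) * m - J.toFun (x - y) * h y := fun y => by
      have := mul_le_mul_of_nonneg_left (hx₁ y) (J.nonneg (x - y))
      simpa using this
    rw [integral_eq_zero_iff_of_nonneg hnn (hi1.sub hi2)] at hzero
    have hzero' := Continuous.ae_eq_iff_eq volume
      ((hJ.mul continuous_const).sub (hJ.mul hcont)) continuous_zero |>.1 hzero
    have hsub : tsupport J.toFun ⊆ {z | h (x - z) = m} := by
      refine closure_minimal (fun z hz => ?_)
        (isClosed_eq (hcont.comp (continuous_const.sub continuous_id)) continuous_const)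
      have : J.toFun (x - (x - z)) * m - J.toFun (x - (x - z)) * h (x - z) = 0 :=
        congrFun hzero' (x - z)
      rw [sub_sub_cancel, ← mul_sub, mul_eq_zero] at this
      rcases this with h0 | h0
      · exact absurd h0 hz
      · exact (sub_eq_zero.1 h0).symm
    rw [J.tsupport_eq] at hsub
    exact fun z hz => hsub hz
  have hclopen : IsClopen {x | h x = m} := by
    refine ⟨isClosed_eq hcont continuous_const, Metric.isOpen_iff.2 fun x hx => ?_⟩
    refine ⟨J.radius, J.radius_pos hN, fun y hy => ?_⟩
    have := hstep x hx (x - y) (by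
      rw [mem_closedBall_zero_iff, ← dist_eq_norm, dist_comm]; exact (Metric.mem_ball.1 hy).le)
    rwa [sub_sub_cancel] at this
  -- a function constantly equal to its maximum `m > 0` does not vanish at infinity
  have huniv := hclopen.eq_univ ⟨x₁, hm.symm⟩
  have : NoncompactSpace (Space N) := NormedSpace.noncompactSpace ℝ (Space N)
  have hconst : Tendsto h (cocompact (Space N)) (𝓝 m) :=
    tendsto_const_nhds.congr fun x => ((huniv ▸ mem_univ x : x ∈ {x | h x = m}) : h x = m).symm
  exact hmpos.ne' (tendsto_nhds_unique hconst hlim)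

/-- Convolution with `J` has no nonzero fixed point in `L¹`. -/
theorem eq_zero_of_conv_eq_self (hN : 1 ≤ N) {v : L1 N} (hv : J.conv v = v) : v = 0 := by
  apply Lp.ext
  have hv' : J.conv (-v) = -v := by rw [J.conv_neg, hv]
  have e : v =ᵐ[volume] J.mollify v := by
    conv_lhs => rw [← hv]
    exact J.coeFn_conv v
  have e' : (-v : L1 N) =ᵐ[volume] J.mollify (-v) := by
    conv_lhs => rw [← hv']
    exact J.coeFn_conv (-v)
  filter_upwards [e, e', Lp.coeFn_neg v, Lp.coeFn_zero ℝ 1 (volume : Measure (Space N))]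
    with x h1 h2 h3 h4
  have p1 := J.nonpos_of_conv_eq_self hN hv x
  have p2 := J.nonpos_of_conv_eq_self hN hv' x
  rw [← h1] at p1
  rw [← h2, h3, Pi.neg_apply] at p2
  rw [h4]
  exact le_antisymm p1 (neg_nonpos.1 p2)

end RadialKernel

/-! ### Pointwise constraints in `L¹` -/

section Constraints

variable {N : ℕ}

theorem isClosed_setOf_ae_mem {S : Space N → Set ℝ} (hS : ∀ x, IsClosed (S x)) :
    IsClosed {v : L1 N | ∀ᵐ x, v x ∈ S x} := by
  refine IsSeqClosed.isClosed fun u v hu huv => ?_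
  obtain ⟨φ, -, hφ⟩ := (tendstoInMeasure_of_tendsto_Lp huv).exists_seq_tendsto_ae
  have hall : ∀ᵐ x, ∀ n, u n x ∈ S x := ae_all_iff.2 hu
  filter_upwards [hall, hφ] with x hx hlim
  exact (hS x).mem_of_tendsto hlim (Eventually.of_forall fun n => hx _)

theorem convex_setOf_ae_mem {S : Space N → Set ℝ} (hS : ∀ x, Convex ℝ (S x)) :
    Convex ℝ {v : L1 N | ∀ᵐ x, v x ∈ S x} := by
  intro v hv w hw a b ha hb hab
  filter_upwards [hv, hw, Lp.coeFn_add (a • v) (b • w), Lp.coeFn_smul a v, Lp.coeFn_smul b w]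
    with x h1 h2 h3 h4 h5
  rw [h3, Pi.add_apply, h4, h5]
  exact hS x h1 h2 ha hb hab

theorem norm_eq_integral_of_nonneg {v : L1 N} (hv : 0 ≤ v) : ‖v‖ = L1.integralCLM v := by
  have e : L1.integralCLM v = ∫ x, v x := by
    rw [← L1.integral_eq, L1.integral_eq_integral]
  rw [e, L1.norm_eq_integral_norm]
  refine integral_congr_ae ?_
  rw [← Lp.coeFn_nonneg] at hv
  filter_upwards [hv] with x hx using Real.norm_of_nonneg hx

end Constraints

/-! ### Coercivity of `v - J ∗ v` on sets of finite measure -/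

namespace RadialKernel

variable {N : ℕ} (J : RadialKernel N)

/-- A bounded sequence of `L¹` has a subsequence along which the convolutions with `J` converge
at every point: by compactness they do so on a countable dense set, and they are equicontinuous. -/
theorem exists_subseq_tendsto_mollify {v : ℕ → L1 N} (hv : ∀ n, ‖v n‖ ≤ 1) :
    ∃ φ : ℕ → ℕ, StrictMono φ ∧ ∃ p : Space N → ℝ,
      ∀ x, Tendsto (fun n => J.mollify (v (φ n)) x) atTop (𝓝 (p x)) := by
  obtain ⟨C, hC0, hC⟩ := J.exists_bound
  have hb : ∀ n x, J.mollify (v n) x ∈ Icc (-C) C := fun n x => by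
    rw [mem_Icc, ← abs_le, ← Real.norm_eq_abs]
    refine (J.norm_mollify_le hC _ x).trans ?_
    exact mul_le_of_le_one_right hC0 (hv n)
  let q := TopologicalSpace.denseSeq (Space N)
  obtain ⟨r, φ, hφ, hr⟩ := CompactSpace.tendsto_subseq
    (fun n k => (⟨J.mollify (v n) (q k), hb n (q k)⟩ : Icc (-C) C))
  have hq : ∀ k, Tendsto (fun n => J.mollify (v (φ n)) (q k)) atTop (𝓝 (r k)) := fun k =>
    (continuous_subtype_val.tendsto _).comp ((tendsto_pi_nhds.1 hr) k)
  have hcauchy : ∀ x, CauchySeq fun n => J.mollify (v (φ n)) x := by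
    intro x
    rw [Metric.cauchySeq_iff]
    intro ε hε
    obtain ⟨δ, hδ, hmod⟩ := J.exists_modulus (by positivity : 0 < ε / 4)
    obtain ⟨k, hk⟩ := (TopologicalSpace.denseRange_denseSeq (Space N)).exists_dist_lt x hδ
    obtain ⟨n₀, hn₀⟩ := Metric.cauchySeq_iff.1 (hq k).cauchySeq (ε / 4) (by positivity)
    refine ⟨n₀, fun m hm n hn => ?_⟩
    have h1 : ∀ i, dist (J.mollify (v i) x) (J.mollify (v i) (q k)) ≤ ε / 4 := fun i => by
      rw [dist_eq_norm]
      exact (hmod (v i) hk).trans (mul_le_of_le_one_right (by positivity) (hv i))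
    have h2 := hn₀ m hm n hn
    have h3 := h1 (φ n)
    rw [dist_comm] at h3
    have := dist_triangle4 (J.mollify (v (φ m)) x) (J.mollify (v (φ m)) (q k))
      (J.mollify (v (φ n)) (q k)) (J.mollify (v (φ n)) x)
    linarith [h1 (φ m)]
  choose p hp using fun x => cauchySeq_tendsto_of_complete (hcauchy x)
  exact ⟨φ, hφ, p, hp⟩

/-- On the functions vanishing off a given set of finite measure, the `L¹` norm is controlled by
the norm of `v - J ∗ v`. Otherwise there is a normalized sequence with `v - J ∗ v → 0`; a
subsequence of `J ∗ v` converges pointwise, hence in `L¹` of the set by dominated convergence, and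
the limit is a nonzero fixed point of the convolution. -/
theorem exists_norm_le_mul_norm_sub_conv (hN : 1 ≤ N) {A : Set (Space N)} (hA : MeasurableSet A)
    (hfin : volume A ≠ ⊤) :
    ∃ C : ℝ, ∀ v : L1 N, (∀ᵐ x, x ∉ A → v x = 0) → ‖v‖ ≤ C * ‖v - J.conv v‖ := by
  by_contra! hcon
  have hseq : ∀ n : ℕ, ∃ v : L1 N, (∀ᵐ x, x ∉ A → v x = 0) ∧ ‖v‖ = 1 ∧
      ‖v - J.conv v‖ ≤ 1 / ((n : ℝ) + 1) := by
    intro n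
    obtain ⟨v, hv0, hv⟩ := hcon (n + 1)
    have hn : (0 : ℝ) < n + 1 := by positivity
    have hpos : 0 < ‖v‖ := lt_of_le_of_lt (by positivity) hv
    refine ⟨‖v‖⁻¹ • v, ?_, ?_, ?_⟩
    · filter_upwards [hv0, Lp.coeFn_smul ‖v‖⁻¹ v] with x h1 h2 hx
      rw [h2, Pi.smul_apply, h1 hx, smul_zero]
    · rw [norm_smul, norm_inv, norm_norm, inv_mul_cancel₀ hpos.ne']
    · rw [J.conv_smul, ← smul_sub, norm_smul, norm_inv, norm_norm, le_div_iff₀ hn,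
        mul_assoc, inv_mul_le_iff₀ hpos, mul_one, mul_comm]
      exact hv.le
  choose v hv0 hv1 hv using hseq
  obtain ⟨φ, hφ, p, hp⟩ := J.exists_subseq_tendsto_mollify fun n => (hv1 n).le
  obtain ⟨C, hC0, hC⟩ := J.exists_bound
  have hmb : ∀ n x, ‖J.mollify (v n) x‖ ≤ C := fun n x => by
    simpa [hv1 n] using J.norm_mollify_le hC (v n) x
  have hpb : ∀ x, ‖p x‖ ≤ C := fun x =>
    le_of_tendsto (hp x).norm (Eventually.of_forall fun n => hmb _ x)
  have hpm : Measurable p := measurable_of_tendsto_metrizable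
    (fun n => (J.continuous_mollify (v (φ n))).measurable) (tendsto_pi_nhds.2 hp)
  have : IsFiniteMeasure (volume.restrict A) := ⟨by simpa using hfin.lt_top⟩
  have hpi : Integrable (A.indicator p) := by
    rw [integrable_indicator_iff hA]
    exact Integrable.of_bound hpm.aestronglyMeasurable C (Eventually.of_forall hpb)
  set V : L1 N := hpi.toL1 (A.indicator p) with hV
  have hdiff : ∀ n, Integrable (A.indicator fun x => ‖J.mollify (v n) x - p x‖) := fun n => by
    rw [integrable_indicator_iff hA]
    refine Integrable.of_bound ((J.continuous_mollify (v n)).measurable.sub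
      hpm).norm.aestronglyMeasurable (C + C) (Eventually.of_forall fun x => ?_)
    rw [norm_norm]
    exact (norm_sub_le _ _).trans (add_le_add (hmb n x) (hpb x))
  have hint : Tendsto (fun n => ∫ x in A, ‖J.mollify (v (φ n)) x - p x‖) atTop (𝓝 0) := by
    have := tendsto_integral_of_dominated_convergence (μ := volume.restrict A)
      (F := fun n x => ‖J.mollify (v (φ n)) x - p x‖) (f := fun _ => 0) (fun _ => C + C)
      (fun n => ((J.continuous_mollify (v (φ n))).measurable.sub hpm).norm.aestronglyMeasurable)
      (integrable_const _) (fun n => Eventually.of_forall fun x => ?_)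
      (Eventually.of_forall fun x => ?_)
    · simpa using this
    · rw [norm_norm]
      exact (norm_sub_le _ _).trans (add_le_add (hmb _ x) (hpb x))
    · simpa using ((hp x).sub_const (p x)).norm
  have hle : ∀ n, ‖v n - V‖ ≤ ‖v n - J.conv (v n)‖ + ∫ x in A, ‖J.mollify (v n) x - p x‖ := by
    intro n
    rw [L1.norm_eq_integral_norm, L1.norm_eq_integral_norm, ← integral_indicator hA,
      ← integral_add (L1.integrable_coeFn _).norm (hdiff n)]
    refine integral_mono_ae (L1.integrable_coeFn _).norm
      ((L1.integrable_coeFn _).norm.add (hdiff n)) ?_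
    filter_upwards [hv0 n, Lp.coeFn_sub (v n) V, Lp.coeFn_sub (v n) (J.conv (v n)),
      J.coeFn_conv (v n), hpi.coeFn_toL1] with x h1 h2 h3 h4 h5
    rw [h2, h3, Pi.sub_apply, Pi.sub_apply, hV, h5, h4]
    by_cases hx : x ∈ A
    · simp only [indicator_of_mem hx]
      exact norm_sub_le_norm_sub_add_norm_sub _ _ _
    · simp only [indicator_of_notMem hx, h1 hx, sub_self, norm_zero, add_zero]
      exact norm_nonneg _
  have hvlim : Tendsto (fun n => v (φ n) - J.conv (v (φ n))) atTop (𝓝 0) :=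
    squeeze_zero_norm (fun n => hv (φ n))
      (tendsto_one_div_add_atTop_nhds_zero_nat.comp hφ.tendsto_atTop)
  have hlim : Tendsto (fun n => v (φ n)) atTop (𝓝 V) := by
    rw [tendsto_iff_norm_sub_tendsto_zero]
    refine squeeze_zero (fun n => norm_nonneg _) (fun n => hle (φ n)) ?_
    simpa using hvlim.norm.add hint
  have hnorm : ‖V‖ = 1 :=
    tendsto_nhds_unique hlim.norm (by simp [hv1])
  have hfix : V - J.conv V = 0 :=
    tendsto_nhds_unique (hlim.sub ((J.convL.continuous.tendsto V).comp hlim)) hvlim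
  rw [J.eq_zero_of_conv_eq_self hN (sub_eq_zero.1 hfix).symm, norm_zero] at hnorm
  exact zero_ne_one hnorm

end RadialKernel

/-! ### The temperature operator -/

theorem Gam_mono : Monotone Gam := fun s t h => by
  rw [Gam_eq, Gam_eq]
  gcongr

theorem sub_Gam_mono : Monotone fun s => s - Gam s := fun s t h => by
  have := Gam_lipschitz.dist_le_mul t s
  rw [NNReal.coe_one, one_mul, Real.dist_eq, Real.dist_eq, abs_of_nonneg (sub_nonneg.2 h),
    abs_of_nonneg (sub_nonneg.2 (Gam_mono h))] at this
  change s - Gam s ≤ t - Gam t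
  linarith

theorem Gam_neg (s : ℝ) : Gam (-s) = -Gam s := by
  rw [Gam_eq, Gam_eq]
  grind

theorem abs_sub_Gam_add_abs_Gam (s : ℝ) : |s - Gam s| + |Gam s| = |s| := by
  have key : ∀ r : ℝ, 0 ≤ r → |r - Gam r| + |Gam r| = |r| := fun r hr => by
    have h1 : 0 ≤ Gam r := by simpa [Gam_zero] using Gam_mono hr
    have h2 : 0 ≤ r - Gam r := by simpa [Gam_zero] using sub_Gam_mono hr
    rw [abs_of_nonneg h1, abs_of_nonneg h2, abs_of_nonneg hr, sub_add_cancel]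
  rcases le_total 0 s with hs | hs
  · exact key s hs
  · have := key (-s) (neg_nonneg.2 hs)
    rwa [Gam_neg, abs_neg, abs_neg, ← neg_sub', abs_neg] at this

theorem Gam_eq_zero_iff {s : ℝ} : Gam s = 0 ↔ |s| ≤ 1 := by
  rw [Gam_eq, abs_le]
  grind

theorem Gam_pos_iff {s : ℝ} : 0 < Gam s ↔ 1 < s := by
  rw [Gam_eq]
  grind

theorem sub_Gam_of_one_le {s : ℝ} (hs : 1 ≤ s) : s - Gam s = 1 := by
  rw [Gam_eq]
  grind

section Temperature

variable {N : ℕ}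

theorem coeFn_temperature (v : L1 N) : ∀ᵐ x, temperature v x = Gam (v x) :=
  Gam_lipschitz.coeFn_compLp Gam_zero v

theorem lipschitzWith_temperature : LipschitzWith 1 (temperature : L1 N → L1 N) :=
  Gam_lipschitz.lipschitzWith_compLp Gam_zero

theorem temperature_zero : temperature (0 : L1 N) = 0 :=
  Gam_lipschitz.compLp_zero Gam_zero

theorem temperature_mono : Monotone (temperature : L1 N → L1 N) := fun v w h => by
  rw [← Lp.coeFn_le] at h ⊢
  filter_upwards [h, coeFn_temperature v, coeFn_temperature w] with x h1 h2 h3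
  rw [h2, h3]
  exact Gam_mono h1

theorem temperature_neg (v : L1 N) : temperature (-v) = -temperature v := by
  apply Lp.ext
  filter_upwards [Lp.coeFn_neg v, Lp.coeFn_neg (temperature v), coeFn_temperature v,
    coeFn_temperature (-v)] with x h1 h2 h3 h4
  rw [h4, h2, h1, Pi.neg_apply, Pi.neg_apply, h3, Gam_neg]

theorem temperature_nonneg {v : L1 N} (hv : 0 ≤ v) : 0 ≤ temperature v := by
  simpa [temperature_zero] using temperature_mono hv

end Temperature

namespace RadialKernel

variable {N : ℕ} (J : RadialKernel N)

/-- The order preserving map `v ↦ v - Γ(v) + J ∗ Γ(v)`; the evolution equation reads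
`u' = stepMap u - u`. -/
noncomputable def stepMap (v : L1 N) : L1 N := v - temperature v + J.conv (temperature v)

theorem lipschitzWith_stepMap : LipschitzWith 3 J.stepMap := by
  refine LipschitzWith.of_dist_le_mul fun v w => ?_
  have h1 := lipschitzWith_temperature.dist_le_mul v w
  rw [NNReal.coe_one, one_mul, dist_eq_norm, dist_eq_norm] at h1
  have e : J.stepMap v - J.stepMap w =
      (v - w) - (temperature v - temperature w) + J.conv (temperature v - temperature w) := by
    rw [stepMap, stepMap, J.conv_sub]
    abel
  rw [dist_eq_norm, dist_eq_norm, e]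
  refine (norm_add_le _ _).trans ?_
  have h2 := norm_sub_le (v - w) (temperature v - temperature w)
  have h3 := J.norm_conv_le (temperature v - temperature w)
  norm_num
  linarith

theorem stepMap_mono : Monotone J.stepMap := fun v w h => by
  refine add_le_add ?_ (J.conv_mono (temperature_mono h))
  rw [← Lp.coeFn_le] at h ⊢
  filter_upwards [h, coeFn_temperature v, coeFn_temperature w, Lp.coeFn_sub v (temperature v),
    Lp.coeFn_sub w (temperature w)] with x h1 h2 h3 h4 h5
  rw [h4, h5, Pi.sub_apply, Pi.sub_apply, h2, h3]
  exact sub_Gam_mono h1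

theorem norm_stepMap_le (v : L1 N) : ‖J.stepMap v‖ ≤ ‖v‖ := by
  have h : ‖v - temperature v‖ + ‖temperature v‖ = ‖v‖ := by
    rw [L1.norm_eq_integral_norm, L1.norm_eq_integral_norm, L1.norm_eq_integral_norm,
      ← integral_add (L1.integrable_coeFn _).norm (L1.integrable_coeFn _).norm]
    refine integral_congr_ae ?_
    filter_upwards [coeFn_temperature v, Lp.coeFn_sub v (temperature v)] with x h1 h2
    rw [h2, Pi.sub_apply, h1]
    exact abs_sub_Gam_add_abs_Gam (v x)
  refine (norm_add_le _ _).trans ?_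
  linarith [J.norm_conv_le (temperature v)]

end RadialKernel

/-! ### Solutions of the evolution equation -/

section Evolution

variable {N : ℕ} {J : RadialKernel N}

theorem exists_isL1Solution (J : RadialKernel N) (f : L1 N) :
    ∃ u : ℝ → L1 N, IsL1Solution J f u := by
  have hF : LipschitzWith 2 fun v : L1 N => J.conv (temperature v) - temperature v := by
    refine LipschitzWith.of_dist_le_mul fun v w => ?_
    have h1 := lipschitzWith_temperature.dist_le_mul v w
    rw [NNReal.coe_one, one_mul, dist_eq_norm, dist_eq_norm] at h1
    rw [dist_eq_norm, dist_eq_norm, sub_sub_sub_comm, ← J.conv_sub]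
    refine (norm_sub_le _ _).trans ?_
    have h2 := J.norm_conv_le (temperature v - temperature w)
    norm_num
    linarith
  obtain ⟨u, hu, h⟩ := exists_global_solution (by norm_num) hF
    (by rw [temperature_zero, J.conv_zero, sub_zero]) f
  exact ⟨u, hu.continuousOn, h⟩

theorem isL1Solution_zero : IsL1Solution J 0 fun _ => 0 := by
  refine ⟨continuousOn_const, fun t _ => ?_⟩
  beta_reduce
  rw [temperature_zero, J.conv_zero, sub_zero, intervalIntegral.integral_zero, add_zero]

namespace IsL1Solution

variable {f g : L1 N} {u v : ℝ → L1 N}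

theorem apply_zero (hu : IsL1Solution J f u) : u 0 = f := by
  simpa using hu.2 0 le_rfl

theorem continuousOn_temperature (hu : IsL1Solution J f u) :
    ContinuousOn (fun t => temperature (u t)) (Ici 0) :=
  lipschitzWith_temperature.continuous.comp_continuousOn hu.1

theorem intervalIntegrable_temperature (hu : IsL1Solution J f u) {t : ℝ} (ht : 0 ≤ t) :
    IntervalIntegrable (fun s => temperature (u s)) volume 0 t := by
  refine (hu.continuousOn_temperature.mono ?_).intervalIntegrable
  rw [uIcc_of_le ht]
  exact Icc_subset_Ici_self

theorem hasDerivWithinAt (hu : IsL1Solution J f u) {t : ℝ} (ht : 0 ≤ t) :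
    HasDerivWithinAt u (J.stepMap (u t) - u t) (Ici t) t := by
  have hc : ContinuousOn (fun s => J.conv (temperature (u s)) - temperature (u s)) (Ici 0) :=
    (J.convL.continuous.comp_continuousOn hu.continuousOn_temperature).sub
      hu.continuousOn_temperature
  have h := (hasDerivWithinAt_integral_Ici hc ht).const_add f
  have e : J.stepMap (u t) - u t = J.conv (temperature (u t)) - temperature (u t) := by
    rw [RadialKernel.stepMap]
    abel
  rw [e]
  exact h.congr (fun s hs => hu.2 s (ht.trans hs)) (hu.2 t ht)

protected theorem neg (hu : IsL1Solution J f u) : IsL1Solution J (-f) fun t => -u t := by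
  refine ⟨hu.1.neg, fun t ht => ?_⟩
  beta_reduce
  rw [hu.2 t ht, neg_add, ← intervalIntegral.integral_neg]
  congr 1
  refine intervalIntegral.integral_congr fun s _ => ?_
  simp only [temperature_neg, J.conv_neg]
  abel

/-- The solution in terms of the time integral of the temperature. -/
theorem eq_conv_sub_integral (hu : IsL1Solution J f u) {t : ℝ} (ht : 0 ≤ t) :
    u t = f + J.conv (∫ s in (0 : ℝ)..t, temperature (u s)) -
      ∫ s in (0 : ℝ)..t, temperature (u s) := by
  have hi := hu.intervalIntegrable_temperature ht
  have hiJ : IntervalIntegrable (fun s => J.conv (temperature (u s))) volume 0 t := by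
    refine ((J.convL.continuous.comp_continuousOn hu.continuousOn_temperature).mono
      ?_).intervalIntegrable
    rw [uIcc_of_le ht]
    exact Icc_subset_Ici_self
  rw [hu.2 t ht, intervalIntegral.integral_sub hiJ hi, ← J.convL_apply,
    ← J.convL.intervalIntegral_comp_comm hi, add_sub_assoc]
  rfl

/-- **Comparison principle.** The difference of two solutions with ordered data stays in the
positive cone because `stepMap` preserves the order. -/
theorem le_of_le (hu : IsL1Solution J f u) (hv : IsL1Solution J g v) (hfg : f ≤ g) {t : ℝ}
    (ht : 0 ≤ t) : u t ≤ v t := by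
  have hconv : Convex ℝ (Ici (0 : L1 N)) := by
    intro a ha b hb c d hc hd _
    have : ∀ (r : ℝ) (z : L1 N), 0 ≤ r → 0 ≤ z → 0 ≤ r • z := fun r z hr hz => by
      rw [← Lp.coeFn_nonneg] at hz ⊢
      filter_upwards [hz, Lp.coeFn_smul r z] with x h1 h2
      rw [h2]
      exact mul_nonneg hr h1
    exact add_nonneg (this c a hc ha) (this d b hd hb)
  have key := mem_of_isClosed_of_convex_of_mapsTo (K := Ici (0 : L1 N)) isClosed_Ici hconv
    -- the equation for `z = v - u`, with `u` regarded as given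
    (H := fun t z => J.stepMap (u t + z) - J.stepMap (u t)) (L := 3)
    (x := fun t => v t - u t) (a := 0) (hv.1.sub hu.1) (fun t ht => ?_) (fun t _ => ?_)
    (fun t _ z hz => ?_) ?_ ht
  · exact sub_nonneg.1 key
  · have e : J.stepMap (u t + (v t - u t)) - J.stepMap (u t) - (v t - u t) =
        J.stepMap (v t) - v t - (J.stepMap (u t) - u t) := by
      rw [add_sub_cancel]
      abel
    exact e ▸ (hv.hasDerivWithinAt ht).sub (hu.hasDerivWithinAt ht)
  · refine LipschitzWith.of_dist_le_mul fun z w => ?_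
    rw [dist_sub_right]
    simpa using J.lipschitzWith_stepMap.dist_le_mul (u t + z) (u t + w)
  · exact sub_nonneg.2 (J.stepMap_mono (le_add_of_nonneg_right hz))
  · simp only [mem_Ici, hv.apply_zero, hu.apply_zero]
    exact sub_nonneg.2 hfg

theorem eqOn (hu : IsL1Solution J f u) (hv : IsL1Solution J f v) : EqOn u v (Ici 0) :=
  fun _ ht => le_antisymm (hu.le_of_le hv le_rfl ht) (hv.le_of_le hu le_rfl ht)

theorem nonneg (hu : IsL1Solution J f u) (hf : 0 ≤ f) {t : ℝ} (ht : 0 ≤ t) : 0 ≤ u t :=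
  isL1Solution_zero.le_of_le hu hf ht

theorem norm_le (hu : IsL1Solution J f u) {t : ℝ} (ht : 0 ≤ t) : ‖u t‖ ≤ ‖f‖ := by
  have key := mem_of_isClosed_of_convex_of_mapsTo (K := Metric.closedBall (0 : L1 N) ‖f‖)
    Metric.isClosed_closedBall (convex_closedBall _ _) (H := fun _ => J.stepMap) (L := 3)
    (x := u) (a := 0) hu.1 (fun t ht => hu.hasDerivWithinAt ht)
    (fun t _ => J.lipschitzWith_stepMap) (fun t _ z hz => ?_) ?_ ht
  · exact mem_closedBall_zero_iff.1 key
  · rw [mem_closedBall_zero_iff] at hz ⊢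
    exact (J.norm_stepMap_le z).trans hz
  · rw [hu.apply_zero, mem_closedBall_zero_iff]

/-- Where `J ∗ Γ(u) ≥ 0` at all times `t ≥ s`, the solution cannot fall below the value `1` after
time `s`: the remaining term `-Γ(u)` of the equation vanishes at that value. -/
theorem one_le_of_one_le (hu : IsL1Solution J f u) {B : Set (Space N)} {s t : ℝ} (hs : 0 ≤ s)
    (hst : s ≤ t) (hB : ∀ r, s ≤ r → ∀ᵐ x, x ∈ B → 0 ≤ J.conv (temperature (u r)) x)
    (h1 : ∀ᵐ x, x ∈ B → 1 ≤ u s x) : ∀ᵐ x, x ∈ B → 1 ≤ u t x := by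
  have hSc : ∀ x : Space N, IsClosed {r : ℝ | x ∈ B → 1 ≤ r} := fun x => by
    by_cases hx : x ∈ B
    · simp only [hx, forall_const]
      exact isClosed_Ici
    · simp [hx]
  have hSv : ∀ x : Space N, Convex ℝ {r : ℝ | x ∈ B → 1 ≤ r} := fun x => by
    by_cases hx : x ∈ B
    · simp only [hx, forall_const]
      exact convex_Ici (𝕜 := ℝ) (1 : ℝ)
    · simpa [hx] using convex_univ
  refine mem_of_isClosed_of_convex_of_mapsTo (isClosed_setOf_ae_mem hSc) (convex_setOf_ae_mem hSv)
    -- the convolution term is frozen along `u`, since its sign is known only there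
    (H := fun t z => z - temperature z + J.conv (temperature (u t))) (L := 2) (x := u) (a := s)
    (hu.1.mono (Ici_subset_Ici.2 hs)) (fun t ht => hu.hasDerivWithinAt (hs.trans ht))
    (fun r _ => ?_) (fun r hr z hz => ?_) h1 hst
  · refine LipschitzWith.of_dist_le_mul fun z w => ?_
    have h := lipschitzWith_temperature.dist_le_mul z w
    rw [NNReal.coe_one, one_mul, dist_eq_norm, dist_eq_norm] at h
    rw [dist_add_right, dist_eq_norm, dist_eq_norm, sub_sub_sub_comm]
    refine (norm_sub_le _ _).trans ?_
    norm_num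
    linarith
  · filter_upwards [hz, hB r hr, Lp.coeFn_add (z - temperature z) (J.conv (temperature (u r))),
      Lp.coeFn_sub z (temperature z), coeFn_temperature z] with x h2 h3 h4 h5 h6 hx
    rw [h4, Pi.add_apply, h5, Pi.sub_apply, h6, sub_Gam_of_one_le (h2 hx)]
    linarith [h3 hx]

/-- A pointwise constraint defined by closed convex cones and satisfied by the temperature at all
times is satisfied by its time integral. -/
theorem ae_integral_temperature_mem (hu : IsL1Solution J f u) {S : Space N → Set ℝ}
    (hSc : ∀ x, IsClosed (S x)) (hSv : ∀ x, Convex ℝ (S x)) (hS0 : ∀ x, (0 : ℝ) ∈ S x)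
    (hSa : ∀ x, ∀ a ∈ S x, ∀ b ∈ S x, a + b ∈ S x)
    (h : ∀ s, 0 ≤ s → ∀ᵐ x, temperature (u s) x ∈ S x) {t : ℝ} (ht : 0 ≤ t) :
    ∀ᵐ x, (∫ s in (0 : ℝ)..t, temperature (u s) : L1 N) x ∈ S x := by
  refine mem_of_isClosed_of_convex_of_mapsTo (isClosed_setOf_ae_mem hSc) (convex_setOf_ae_mem hSv)
    (H := fun s z => z + temperature (u s)) (L := 1)
    (x := fun t => ∫ s in (0 : ℝ)..t, temperature (u s)) (a := 0)
    (fun s hs => ?_) (fun s hs => ?_) (fun s _ => ?_) (fun s hs z hz => ?_) ?_ ht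
  · have hcont := intervalIntegral.continuousOn_primitive_interval'
      (hu.intervalIntegrable_temperature (le_trans hs (by linarith : s ≤ s + 1))) left_mem_uIcc
    rw [uIcc_of_le (le_trans hs (by linarith : s ≤ s + 1))] at hcont
    refine (hcont s ⟨hs, by linarith⟩).mono_of_mem_nhdsWithin ?_
    refine mem_nhdsWithin.2 ⟨Iio (s + 1), isOpen_Iio, by simp, fun r hr => ⟨hr.2, le_of_lt hr.1⟩⟩
  · simpa using hasDerivWithinAt_integral_Ici hu.continuousOn_temperature hs
  · exact LipschitzWith.of_dist_le_mul fun z w => by simp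
  · filter_upwards [hz, h s hs, Lp.coeFn_add z (temperature (u s))] with x h1 h2 h3
    rw [h3]
    exact hSa x _ h1 _ h2
  · rw [Set.mem_ofPred_eq, intervalIntegral.integral_same]
    filter_upwards [Lp.coeFn_zero ℝ 1 (volume : Measure (Space N))] with x hx
    rw [hx]
    exact hS0 x

end IsL1Solution

end Evolution

/-! ### One-phase solutions -/

section OnePhase

variable {N : ℕ} {J : RadialKernel N} {g : L1 N} {U : ℝ → L1 N}

namespace IsL1Solution

/-- For nonnegative data the temperatures at all times vanish off a common set of finite measure.
The sets `{U(n) ≥ 1}` increase with `n`, by the persistence of the phase, and each has measure at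
most `‖g‖`, by Chebyshev's inequality. -/
theorem exists_measurableSet_temperature_eq_zero (hU : IsL1Solution J g U) (hg : 0 ≤ g) :
    ∃ A : Set (Space N), MeasurableSet A ∧ volume A ≠ ⊤ ∧
      ∀ t, 0 ≤ t → ∀ᵐ x, x ∉ A → temperature (U t) x = 0 := by
  have hpersist : ∀ s t, 0 ≤ s → s ≤ t → ∀ᵐ x, 1 ≤ U s x → 1 ≤ U t x := by
    intro s t hs hst
    refine hU.one_le_of_one_le (B := {x | 1 ≤ U s x}) hs hst (fun r hr => ?_)
      (Eventually.of_forall fun x hx => hx)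
    have := J.conv_nonneg (temperature_nonneg (hU.nonneg hg (hs.trans hr)))
    rw [← Lp.coeFn_nonneg] at this
    filter_upwards [this] with x hx _ using hx
  let A : ℕ → Set (Space N) := fun n => {x | 1 ≤ U n x}
  have hAm : ∀ n, MeasurableSet (A n) := fun n =>
    measurableSet_le measurable_const (Lp.stronglyMeasurable (U n)).measurable
  have hAvol : ∀ n, volume (A n) ≤ ENNReal.ofReal ‖g‖ := by
    intro n
    have h1 := mul_meas_ge_le_integral_of_nonneg (μ := (volume : Measure (Space N)))
      (Eventually.of_forall fun x => norm_nonneg (U n x)) (L1.integrable_coeFn (U n)).norm 1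
    rw [one_mul, ← L1.norm_eq_integral_norm] at h1
    have hfin := (L1.integrable_coeFn (U n)).measure_norm_ge_lt_top one_pos
    refine (measure_mono fun x (hx : 1 ≤ U n x) => ?_ :
      volume (A n) ≤ volume {x | 1 ≤ ‖U n x‖}).trans ?_
    · exact hx.trans (le_abs_self _)
    · rw [← ENNReal.ofReal_toReal hfin.ne]
      exact ENNReal.ofReal_le_ofReal (h1.trans (hU.norm_le n.cast_nonneg))
  refine ⟨⋃ n, A n, MeasurableSet.iUnion hAm, ?_, fun t ht => ?_⟩
  · rw [measure_iUnion_eq_iSup_accumulate]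
    refine ne_top_of_le_ne_top (ENNReal.ofReal_ne_top (r := ‖g‖)) (iSup_le fun n => ?_)
    refine (measure_mono_ae ?_).trans (hAvol n)
    have : ∀ᵐ x, ∀ m : ℕ, m ≤ n → 1 ≤ U m x → 1 ≤ U n x := by
      refine ae_all_iff.2 fun m => ?_
      by_cases hmn : m ≤ n
      · filter_upwards [hpersist m n m.cast_nonneg (Nat.cast_le.2 hmn)] with x hx _ using hx
      · exact Eventually.of_forall fun x h => absurd h hmn
    filter_upwards [this] with x hx hxA
    obtain ⟨m, hmn, hm⟩ := mem_accumulate.1 hxA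
    exact hx m hmn hm
  · obtain ⟨n, hn⟩ := exists_nat_ge t
    have hnn := hU.nonneg hg ht
    rw [← Lp.coeFn_nonneg] at hnn
    filter_upwards [hpersist t n ht hn, hnn, coeFn_temperature (U t)] with x h1 h2 h3 hx
    rw [h3, Gam_eq_zero_iff, abs_of_nonneg h2]
    by_contra! hlt
    exact hx (mem_iUnion.2 ⟨n, h1 hlt.le⟩)

/-- The temperature of a one-phase solution is integrable in time: its time integral `W`
satisfies `W - J ∗ W = g - U`, which is bounded, and vanishes off a set of finite measure. -/
theorem integrableOn_norm_temperature_of_nonneg (hN : 1 ≤ N) (hU : IsL1Solution J g U)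
    (hg : 0 ≤ g) : IntegrableOn (fun t => ‖temperature (U t)‖) (Ioi 0) := by
  obtain ⟨A, hA, hfin, hzero⟩ := hU.exists_measurableSet_temperature_eq_zero hg
  obtain ⟨C, hC⟩ := J.exists_norm_le_mul_norm_sub_conv hN hA hfin
  have hsupp : ∀ t, 0 ≤ t →
      ∀ᵐ x, x ∉ A → (∫ s in (0 : ℝ)..t, temperature (U s) : L1 N) x = 0 := fun t ht => by
    refine hU.ae_integral_temperature_mem (S := fun x => {r | x ∉ A → r = 0}) (fun x => ?_)
      (fun x => ?_) (fun x _ => rfl) (fun x a ha b hb hx => ?_) hzero ht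
    · by_cases hx : x ∈ A
      · simp [hx]
      · simp [hx]
    · by_cases hx : x ∈ A
      · simpa [hx] using convex_univ
      · simp [hx]
    · rw [ha hx, hb hx, add_zero]
  have hbound : ∀ t, 0 ≤ t → ‖∫ s in (0 : ℝ)..t, temperature (U s)‖ ≤ |C| * (‖g‖ + ‖g‖) := by
    intro t ht
    have e : (∫ s in (0 : ℝ)..t, temperature (U s)) -
        J.conv (∫ s in (0 : ℝ)..t, temperature (U s)) = g - U t := by
      rw [hU.eq_conv_sub_integral ht]
      abel
    refine (hC _ (hsupp t ht)).trans ?_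
    rw [e]
    refine mul_le_mul (le_abs_self C) ?_ (norm_nonneg _) (abs_nonneg C)
    exact (norm_sub_le _ _).trans (add_le_add le_rfl (hU.norm_le ht))
  refine integrableOn_Ioi_of_intervalIntegral_norm_bounded
    (‖(L1.integralCLM : L1 N →L[ℝ] ℝ)‖ * (|C| * (‖g‖ + ‖g‖))) 0 (fun t => ?_) tendsto_id ?_
  · rcases le_total 0 t with ht | ht
    · exact ((intervalIntegrable_iff_integrableOn_Ioc_of_le ht).1
        (hU.intervalIntegrable_temperature ht)).norm
    · simp [Ioc_eq_empty (not_lt.2 ht)]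
  · filter_upwards [eventually_ge_atTop 0] with t ht
    have e : ∫ s in (0 : ℝ)..t, ‖‖temperature (U s)‖‖ =
        L1.integralCLM (∫ s in (0 : ℝ)..t, temperature (U s)) := by
      rw [← ContinuousLinearMap.intervalIntegral_comp_comm _
        (hU.intervalIntegrable_temperature ht)]
      refine intervalIntegral.integral_congr fun s hs => ?_
      rw [uIcc_of_le ht] at hs
      simp only [norm_norm]
      exact norm_eq_integral_of_nonneg (temperature_nonneg (hU.nonneg hg hs.1))
    simp only [id]
    rw [e]
    refine (Real.le_norm_self _).trans ((ContinuousLinearMap.le_opNorm _ _).trans ?_)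
    gcongr
    exact hbound t ht

end IsL1Solution

end OnePhase

/-! ### Two-phase solutions -/

section TwoPhase

variable {N : ℕ} {J : RadialKernel N} {f : L1 N} {u : ℝ → L1 N}

theorem le_posPart (f : L1 N) : f ≤ Lp.posPart f := by
  rw [← Lp.coeFn_le]
  filter_upwards [Lp.coeFn_posPart f] with x hx
  rw [hx]
  exact le_max_left _ _

theorem posPart_nonneg (f : L1 N) : 0 ≤ Lp.posPart f := by
  rw [← Lp.coeFn_nonneg]
  filter_upwards [Lp.coeFn_posPart f] with x hx
  rw [hx]
  exact le_max_right _ _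

namespace IsL1Solution

theorem neg_le_of_negPart {V : ℝ → L1 N} (hu : IsL1Solution J f u)
    (hV : IsL1Solution J (Lp.negPart f) V) {t : ℝ} (ht : 0 ≤ t) : -u t ≤ V t :=
  hu.neg.le_of_le hV (le_posPart (-f)) ht

/-- The temperature of an arbitrary solution is integrable in time, by comparison with the
one-phase solutions whose data are the positive and the negative part of the datum. -/
theorem integrableOn_norm_temperature (hN : 1 ≤ N) (hu : IsL1Solution J f u) :
    IntegrableOn (fun t => ‖temperature (u t)‖) (Ioi 0) := by
  obtain ⟨U, hU⟩ := exists_isL1Solution J (Lp.posPart f)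
  obtain ⟨V, hV⟩ := exists_isL1Solution J (Lp.negPart f)
  have hi := (hU.integrableOn_norm_temperature_of_nonneg hN (posPart_nonneg f)).add
    (hV.integrableOn_norm_temperature_of_nonneg hN (posPart_nonneg (-f)))
  refine Integrable.mono' hi ((hu.continuousOn_temperature.mono
    Ioi_subset_Ici_self).norm.aestronglyMeasurable measurableSet_Ioi) ?_
  filter_upwards [ae_restrict_mem measurableSet_Ioi] with t ht
  have ht0 : 0 ≤ t := le_of_lt ht
  have h1 := temperature_mono (hu.le_of_le hU (le_posPart f) ht0)
  have h2 := temperature_mono (hu.neg_le_of_negPart hV ht0)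
  rw [temperature_neg] at h2
  have hU0 := temperature_nonneg (hU.nonneg (posPart_nonneg f) ht0)
  have hV0 := temperature_nonneg (hV.nonneg (posPart_nonneg (-f)) ht0)
  rw [norm_norm, Pi.add_apply]
  refine le_trans (norm_le_norm_of_abs_le_abs ?_) (norm_add_le _ _)
  rw [abs_of_nonneg (add_nonneg hU0 hV0)]
  exact abs_le'.2 ⟨h1.trans (le_add_of_nonneg_right hV0), h2.trans (le_add_of_nonneg_left hU0)⟩

/-- The time integral of the temperature converges in `L¹`. -/
theorem exists_tendsto_integral_temperature (hN : 1 ≤ N) (hu : IsL1Solution J f u) :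
    ∃ w : L1 N, Tendsto (fun t => ∫ s in (0 : ℝ)..t, temperature (u s)) atTop (𝓝 w) := by
  have hi : IntegrableOn (fun t => temperature (u t)) (Ioi 0) := by
    refine (integrable_norm_iff ?_).1 (hu.integrableOn_norm_temperature hN)
    exact (hu.continuousOn_temperature.mono
      Ioi_subset_Ici_self).aestronglyMeasurable measurableSet_Ioi
  exact ⟨_, intervalIntegral_tendsto_integral_Ioi 0 hi tendsto_id⟩

theorem tendsto_of_tendsto_integral {w : L1 N} (hu : IsL1Solution J f u)
    (hw : Tendsto (fun t => ∫ s in (0 : ℝ)..t, temperature (u s)) atTop (𝓝 w)) :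
    Tendsto u atTop (𝓝 (f + J.conv w - w)) := by
  have h := (((J.convL.continuous.tendsto w).comp hw).const_add f).sub hw
  refine h.congr' ?_
  filter_upwards [eventually_ge_atTop 0] with t ht
  exact (hu.eq_conv_sub_integral ht).symm

/-- The limit of a solution has no temperature, since the temperature is integrable in time. -/
theorem ae_abs_limit_le_one (hN : 1 ≤ N) (hu : IsL1Solution J f u) {l : L1 N}
    (hl : Tendsto u atTop (𝓝 l)) : ∀ᵐ x, |l x| ≤ 1 := by
  have h1 : Tendsto (fun t => ‖temperature (u t)‖) atTop (𝓝 ‖temperature l‖) :=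
    ((lipschitzWith_temperature.continuous.tendsto l).comp hl).norm
  have h2 := eq_zero_of_tendsto_of_integrableOn_Ioi h1 (hu.integrableOn_norm_temperature hN)
  rw [norm_eq_zero] at h2
  filter_upwards [coeFn_temperature l, Lp.coeFn_zero ℝ 1 (volume : Measure (Space N))]
    with x hx h0
  rw [h2, h0] at hx
  exact Gam_eq_zero_iff.1 hx.symm

end IsL1Solution

/-- An integrable function vanishes almost everywhere off its distributional support. -/
theorem ae_eq_zero_of_notMem_distSupport (v : L1 N) : ∀ᵐ x, x ∉ distSupport v → v x = 0 := by
  set S := {O : Set (Space N) | IsOpen O ∧ ∀ φ : Space N → ℝ, ContDiff ℝ ∞ φ →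
    HasCompactSupport φ → tsupport φ ⊆ O → ∫ x, v x * φ x = 0} with hS
  obtain ⟨T, hTc, hTS, hTU⟩ := TopologicalSpace.isOpen_sUnion_countable S fun O hO => hO.1
  have hT : ∀ᵐ x, ∀ O ∈ T, x ∈ O → v x = 0 := by
    refine (ae_ball_iff hTc).2 fun O hO => ?_
    obtain ⟨hopen, hO0⟩ := hTS hO
    refine hopen.ae_eq_zero_of_integral_contDiff_smul_eq_zero
      ((L1.integrable_coeFn v).locallyIntegrable.locallyIntegrableOn O) fun φ h1 h2 h3 => ?_
    rw [← hO0 φ h1 h2 h3]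
    exact integral_congr_ae (Eventually.of_forall fun x => by simp [mul_comm])
  filter_upwards [hT] with x hx hxs
  have hxU : x ∈ ⋃₀ T := by
    rw [hTU]
    exact not_not.1 hxs
  obtain ⟨O, hO, hxO⟩ := hxU
  exact hx O hO hxO

theorem ae_temperature_eq_zero_of_notMem {g : L1 N} {U : ℝ → L1 N} (hU : IsL1Solution J g U)
    {t : ℝ} (ht : 0 ≤ t) :
    ∀ᵐ x, x ∉ limitTemperatureSupport J g → temperature (U t) x = 0 := by
  filter_upwards [ae_eq_zero_of_notMem_distSupport (temperature (U t))] with x hx hxs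
  exact hx fun hmem => hxs (subset_closure ⟨U, hU, t, ht, hmem⟩)

theorem TemperaturesSeparated.neg (h : TemperaturesSeparated J f) :
    TemperaturesSeparated J (-f) := fun x hx y hy => by
  have hpos : Lp.negPart (-f) = Lp.posPart f := by
    rw [Lp.negPart, neg_neg]
  rw [hpos] at hy
  rw [dist_comm]
  exact h y hy x hx

namespace IsL1Solution

/-- If the limit supports are separated, the negative temperatures do not reach the region where
positive temperatures occur: they are confined to the limit support of the negative one-phase
solution, outside the range of the kernel. -/
theorem mollify_temperature_nonneg (hN : 1 ≤ N) (hsep : TemperaturesSeparated J f)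
    (hu : IsL1Solution J f u) {t : ℝ} (ht : 0 ≤ t) {x : Space N}
    (hx : x ∈ limitTemperatureSupport J (Lp.posPart f)) :
    0 ≤ J.mollify (temperature (u t)) x := by
  obtain ⟨V, hV⟩ := exists_isL1Solution J (Lp.negPart f)
  refine J.mollify_nonneg ?_
  have h2 := temperature_mono (hu.neg_le_of_negPart hV ht)
  rw [temperature_neg, ← Lp.coeFn_le] at h2
  filter_upwards [h2, Lp.coeFn_neg (temperature (u t)), ae_temperature_eq_zero_of_notMem hV ht]
    with y h3 h4 h5
  by_cases hy : y ∈ limitTemperatureSupport J (Lp.negPart f)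
  · have hd := hsep x hx y hy
    rw [dist_eq_norm] at hd
    rw [J.toFun_eq_zero hN hd, zero_mul]
  · rw [h4, Pi.neg_apply, h5 hy] at h3
    exact mul_nonneg (J.nonneg _) (neg_nonpos.1 h3)

/-- Under the separation hypothesis a point that has once had positive temperature stays in the
positive phase. -/
theorem ae_one_le_of_one_lt (hN : 1 ≤ N) (hsep : TemperaturesSeparated J f)
    (hu : IsL1Solution J f u) {s t : ℝ} (hs : 0 ≤ s) (hst : s ≤ t) :
    ∀ᵐ x, 1 < u s x → 1 ≤ u t x := by
  obtain ⟨U, hU⟩ := exists_isL1Solution J (Lp.posPart f)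
  have hmem : ∀ᵐ x, 1 < u s x → x ∈ limitTemperatureSupport J (Lp.posPart f) := by
    have h1 := hu.le_of_le hU (le_posPart f) hs
    rw [← Lp.coeFn_le] at h1
    filter_upwards [h1, coeFn_temperature (U s), ae_temperature_eq_zero_of_notMem hU hs]
      with x h2 h3 h4 hx
    by_contra hns
    have := Gam_pos_iff.2 (hx.trans_le h2)
    rw [← h3, h4 hns] at this
    exact lt_irrefl _ this
  have key := hu.one_le_of_one_le
    (B := {x | x ∈ limitTemperatureSupport J (Lp.posPart f) ∧ 1 < u s x}) hs hst
    (fun r hr => ?_) (Eventually.of_forall fun x hx => hx.2.le)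
  · filter_upwards [key, hmem] with x h1 h2 hx using h1 ⟨h2 hx, hx⟩
  · filter_upwards [J.coeFn_conv (temperature (u r))] with x hx hxB
    rw [hx]
    exact hu.mollify_temperature_nonneg hN hsep (hs.trans hr) hxB.1

/-- Where the limit `l` is below `1`, the temperature was never positive, and hence neither is its
time integral. -/
theorem ae_one_le_limit_of_pos (hN : 1 ≤ N) (hsep : TemperaturesSeparated J f)
    (hu : IsL1Solution J f u) {l w : L1 N} (hl : Tendsto u atTop (𝓝 l))
    (hw : Tendsto (fun t => ∫ s in (0 : ℝ)..t, temperature (u s)) atTop (𝓝 w)) :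
    ∀ᵐ x, 0 < w x → 1 ≤ l x := by
  have hlim : ∀ s, 0 ≤ s → ∀ᵐ x, 1 < u s x → 1 ≤ l x := by
    intro s hs
    have hclosed : IsClosed {v : L1 N | ∀ᵐ x, v x ∈ {r : ℝ | 1 < u s x → 1 ≤ r}} := by
      refine isClosed_setOf_ae_mem fun x => ?_
      by_cases hx : 1 < u s x
      · simp only [hx, forall_const]
        exact isClosed_Ici
      · simp [hx]
    refine hclosed.mem_of_tendsto hl ?_
    filter_upwards [eventually_ge_atTop s] with t hst
    exact hu.ae_one_le_of_one_lt hN hsep hs hst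
  let S : Space N → Set ℝ := fun x => {r | l x < 1 → r ≤ 0}
  have hSc : ∀ x, IsClosed (S x) := fun x => by
    by_cases hx : l x < 1
    · simp only [S, hx, forall_const]
      exact isClosed_Iic
    · simp [S, hx]
  have hSv : ∀ x, Convex ℝ (S x) := fun x => by
    by_cases hx : l x < 1
    · simp only [S, hx, forall_const]
      exact convex_Iic (𝕜 := ℝ) (0 : ℝ)
    · simpa [S, hx] using convex_univ
  have hwS : ∀ᵐ x, w x ∈ S x := by
    refine (isClosed_setOf_ae_mem hSc).mem_of_tendsto hw ?_
    filter_upwards [eventually_ge_atTop 0] with t ht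
    refine hu.ae_integral_temperature_mem hSc hSv (fun x _ => le_rfl)
      (fun x a ha b hb hx => add_nonpos (ha hx) (hb hx)) (fun s hs => ?_) ht
    filter_upwards [hlim s hs, coeFn_temperature (u s)] with x h1 h2 hx
    rw [h2]
    by_contra! hpos
    exact absurd (h1 (Gam_pos_iff.1 hpos)) (not_le.2 hx)
  filter_upwards [hwS] with x hx hpos
  by_contra! hlt
  exact absurd (hx hlt) (not_le.2 hpos)

/-- The total time integral of the temperature solves the biobstacle problem. -/
theorem isBiobstacleSolution (hN : 1 ≤ N) (hsep : TemperaturesSeparated J f)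
    (hu : IsL1Solution J f u) {w : L1 N}
    (hw : Tendsto (fun t => ∫ s in (0 : ℝ)..t, temperature (u s)) atTop (𝓝 w)) :
    IsBiobstacleSolution J f w := by
  have hl := hu.tendsto_of_tendsto_integral hw
  have hw' : Tendsto (fun t => ∫ s in (0 : ℝ)..t, temperature (-u s)) atTop (𝓝 (-w)) := by
    simp only [temperature_neg, intervalIntegral.integral_neg]
    exact hw.neg
  filter_upwards [hu.ae_abs_limit_le_one hN hl, hu.ae_one_le_limit_of_pos hN hsep hl hw,
    hu.neg.ae_one_le_limit_of_pos hN hsep.neg hl.neg hw', Lp.coeFn_neg w,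
    Lp.coeFn_neg (f + J.conv w - w)] with x h1 h2 h3 h4 h5
  refine ⟨h1, fun hne => ?_⟩
  rw [h4, h5, Pi.neg_apply, Pi.neg_apply] at h3
  rw [abs_le] at h1
  rcases lt_or_gt_of_ne hne with hneg | hpos
  · rw [Real.sign_of_neg hneg]
    linarith [h3 (neg_pos.2 hneg)]
  · rw [Real.sign_of_pos hpos]
    linarith [h2 hpos]

end IsL1Solution

/-! ### Uniqueness for the biobstacle problem -/

theorem mul_nonneg_of_mem_signGraph {r s a b : ℝ} (ha : a ∈ signGraph r) (hb : b ∈ signGraph s) :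
    0 ≤ (r - s) * (a - b) := by
  obtain ⟨ha1, ha2⟩ := ha
  obtain ⟨hb1, hb2⟩ := hb
  have key : ∀ {r a b : ℝ}, (r ≠ 0 → a = Real.sign r) → |b| ≤ 1 → 0 ≤ r * (a - b) := by
    intro r a b ha hb
    rw [abs_le] at hb
    rcases lt_trichotomy r 0 with h | h | h
    · rw [ha h.ne, Real.sign_of_neg h]
      exact mul_nonneg_of_nonpos_of_nonpos h.le (by linarith)
    · rw [h, zero_mul]
    · rw [ha h.ne', Real.sign_of_pos h]
      exact mul_nonneg h.le (by linarith)
  have h1 := key ha2 hb1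
  have h2 := key hb2 ha1
  linarith

/-- The difference `w` of two solutions satisfies `J ∗ w = w + b` with `b w ≥ 0`, so that
`‖J ∗ w‖ = ‖w‖ + ‖b‖`; as convolution is a contraction, `b = 0` and `w` is a fixed point. -/
theorem IsBiobstacleSolution.eq (hN : 1 ≤ N) {w w' : L1 N} (hw : IsBiobstacleSolution J f w)
    (hw' : IsBiobstacleSolution J f w') : w = w' := by
  set b := f + J.conv w - w - (f + J.conv w' - w') with hb
  have hconv : J.conv (w - w') = (w - w') + b := by
    rw [J.conv_sub, hb]
    abel
  have hnorm : ‖w - w' + b‖ = ‖w - w'‖ + ‖b‖ := by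
    rw [L1.norm_eq_integral_norm, L1.norm_eq_integral_norm, L1.norm_eq_integral_norm,
      ← integral_add (L1.integrable_coeFn _).norm (L1.integrable_coeFn _).norm]
    refine integral_congr_ae ?_
    filter_upwards [hw, hw', Lp.coeFn_add (w - w') b, Lp.coeFn_sub w w',
      Lp.coeFn_sub (f + J.conv w - w) (f + J.conv w' - w')] with x h1 h2 h3 h4 h5
    have h := mul_nonneg_of_mem_signGraph h1 h2
    rw [h3, Pi.add_apply, h4, hb, h5, Pi.sub_apply, Pi.sub_apply]
    rw [Real.norm_eq_abs, Real.norm_eq_abs, Real.norm_eq_abs, abs_add_eq_add_abs_iff]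
    exact mul_nonneg_iff.1 h
  have hle := J.norm_conv_le (w - w')
  rw [hconv, hnorm] at hle
  have hb0 : b = 0 := norm_le_zero_iff.1 (by linarith)
  rw [hb0, add_zero] at hconv
  exact sub_eq_zero.1 (J.eq_zero_of_conv_eq_self hN hconv)

end TwoPhase

end NonlocalStefan

theorem mainTheorem1 (N : ℕ) (hN : 1 ≤ N) (J : NonlocalStefan.RadialKernel N)
    (f : NonlocalStefan.L1 N)
    (hsep : NonlocalStefan.TemperaturesSeparated J f)
    (hlow : N ≤ 2 → NonlocalStefan.LowDimensionHypotheses J f) :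
    (∃ u : ℝ → NonlocalStefan.L1 N, NonlocalStefan.IsL1Solution J f u ∧
      ∀ u' : ℝ → NonlocalStefan.L1 N, NonlocalStefan.IsL1Solution J f u' →
        Set.EqOn u' u (Set.Ici 0)) ∧
    (∃! w : NonlocalStefan.L1 N, NonlocalStefan.IsBiobstacleSolution J f w) ∧
    ∀ (u : ℝ → NonlocalStefan.L1 N) (w : NonlocalStefan.L1 N),
      NonlocalStefan.IsL1Solution J f u → NonlocalStefan.IsBiobstacleSolution J f w →
        Filter.Tendsto u Filter.atTop (nhds (f + J.conv w - w)) := by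
  obtain ⟨u, hu⟩ := NonlocalStefan.exists_isL1Solution J f
  obtain ⟨w, hw⟩ := hu.exists_tendsto_integral_temperature hN
  have hbop := hu.isBiobstacleSolution hN hsep hw
  refine ⟨⟨u, hu, fun u' hu' => hu'.eqOn hu⟩, ⟨w, hbop, fun w' hw' => hw'.eq hN hbop⟩, ?_⟩
  intro u' w' hu' hw'
  rw [hw'.eq hN hbop]
  refine (hu.tendsto_of_tendsto_integral hw).congr' ?_
  filter_upwards [eventually_ge_atTop 0] with t ht
  exact hu.eqOn hu' ht
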